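/- Let $\mathcal H=\bigotimes_{j=1}^m\mathbb C^{d_j}$ be a multipartite Hilbert space with all $d_j\ge 1$, and let $\mu$ be the uniform (unitarily invariant) probability measure on the projective space $\mathrm P(\mathcal H)$ of pure states. Pure states $\psi_1,\dots,\psi_n$ of a multipartite Hilbert space are called unambiguously locally distinguishable if there is a POVM $\{E_k\}_{k=0,\dots,n}$ that is implementable by a (finite) protocol of local operations of the parties and classical communication, such that for all $j,k\in\{1,\dots,n\}$: $\langle\psi_j|E_k|\psi_j\rangle=0$ if and only if $j\ne k$. The members of $\psi_1,\dots,\psi_n$ are locally unambiguously distinguishable, given $c$ separated copies of the unknown member, if the states $\psi_1^{\otimes c},\dots,\psi_n^{\otimes c}$ of $\mathcal H^{\otimes c}=\bigotimes_{t=1}^{c}\bigotimes_{j=1}^m\mathbb C^{d_j}$, regarded as a system of $cm$ separate parties, are unambiguously locally distinguishable. Then for $\mu\times\dots\times\mu$-almost all $n$-tuples $(\psi_1,\dots,\psi_n)$ of pure states of $\mathcal H$, the following holds for every integer $c\ge 0$: if the members of $\psi_1,\dots,\psi_n$ are locally unambiguously distinguishable given $c$ separated copies of the unknown member, then $$c\;\ge\;\frac{n-1}{\sum_{j}(d_j-1)}\;,$$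 where in the degenerate case $\sum_j(d_j-1)=0$ the conclusion means $n\le 1$. -/

import Mathlib

open MeasureTheory
open scoped ComplexOrder ENNReal Matrix

noncomputable section

/-! ## Pure states and the uniform measure -/

/-- The pure states of the Hilbert space `ℂ^I`: the points of its projective space. -/
def PureState (I : Type*) [Fintype I] : Type _ :=
  Projectivization ℂ (EuclideanSpace ℂ I)

namespace PureState

variable {I : Type*} [Fintype I]

/-- The pure state (line) spanned by a unit vector. -/
def ofUnit (v : Metric.sphere (0 : EuclideanSpace ℂ I) 1) : PureState I :=
  Projectivization.mk ℂ (v : EuclideanSpace ℂ I) (ne_zero_of_mem_unit_sphere v)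

/-- A unit vector `|ψ⟩` representing the pure state `ψ` (it is unique up to a phase). -/
def ket (ψ : PureState I) : EuclideanSpace ℂ I :=
  ((‖Projectivization.rep ψ‖⁻¹ : ℝ) : ℂ) • Projectivization.rep ψ

/-- Projective space carries the quotient topology of `ℂ^I \ {0}`. -/
instance : TopologicalSpace (PureState I) :=
  TopologicalSpace.coinduced
    (Projectivization.mk' ℂ :
      { v : EuclideanSpace ℂ I // v ≠ 0 } → Projectivization ℂ (EuclideanSpace ℂ I))
    inferInstance

instance : MeasurableSpace (PureState I) := borel (PureState I)

instance : BorelSpace (PureState I) := ⟨rfl⟩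

variable (I) in
/-- The uniform probability measure on the unit sphere of `ℂ^I`: normalized surface area. -/
def sphereMeasure : Measure (Metric.sphere (0 : EuclideanSpace ℂ I) 1) :=
  ((volume : Measure (EuclideanSpace ℂ I)).toSphere Set.univ)⁻¹ •
    (volume : Measure (EuclideanSpace ℂ I)).toSphere

variable (I) in
/-- The uniform (unitarily invariant) probability measure on the pure states of `ℂ^I`: the law of
the state spanned by a uniformly distributed unit vector. -/
def uniformMeasure : Measure (PureState I) :=
  (sphereMeasure I).map ofUnit

end PureState

/-! ## Multipartite systems

The system of parties `j : ι` with local spaces `ℂ^(d j)` has the Hilbert space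
`⨂ j, ℂ^(d j) = ℂ^(∏ j, Fin (d j))`, written in coordinates with respect to the product of the
standard bases. -/

section Multipartite

variable {ι : Type*}

/-- The labels `(k_j)_j` of the standard product basis of `⨂ j, ℂ^(d j)`. -/
abbrev BasisIndex (d : ι → ℕ) : Type _ := ∀ j, Fin (d j)

/-- The operator `K ⊗ 1` where party `j` applies `K : ℂ^(d j) → ℂ^r` and the other parties do
nothing. Party `j` holds `ℂ^r` afterwards. -/
def localOp [DecidableEq ι] [Fintype ι] (d : ι → ℕ) (j : ι) {r : ℕ}
    (K : Matrix (Fin r) (Fin (d j)) ℂ) :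
    Matrix (BasisIndex (Function.update d j r)) (BasisIndex d) ℂ :=
  Matrix.of fun x y =>
    if ∀ i, i ≠ j → (x i : ℕ) = (y i : ℕ) then K (Fin.cast (by simp) (x j)) (y j) else 0

/-- POVMs with outcomes in `κ` implemented by protocols of local operations and classical
communication, with finitely many rounds. Either the protocol stops and announces an outcome `k₀`,
or some party `j` performs a local measurement with Kraus operators `K a : ℂ^(d j) → ℂ^(r a)`,
broadcasts the result `a`, and the parties continue with an LOCC protocol `F a` that may depend
on `a`. (Ancillas are covered, as the local dimension may change; local randomness is a
measurement with Kraus operators `√p_a • 1`; forgetting information is a continuation that does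
not depend on `a`.) -/
inductive IsLOCC [DecidableEq ι] [Fintype ι] {κ : Type} [DecidableEq κ] : (d : ι → ℕ) →
    (κ → Matrix (BasisIndex d) (BasisIndex d) ℂ) → Prop
  | announce (d : ι → ℕ) (k₀ : κ) : IsLOCC d (fun k => if k = k₀ then 1 else 0)
  | measure (d : ι → ℕ) (j : ι) (s : ℕ) (r : Fin s → ℕ)
      (K : (a : Fin s) → Matrix (Fin (r a)) (Fin (d j)) ℂ)
      (hK : ∑ a, (K a)ᴴ * K a = 1)
      (F : (a : Fin s) → κ → Matrix (BasisIndex (Function.update d j (r a)))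
        (BasisIndex (Function.update d j (r a))) ℂ)
      (hF : ∀ a, IsLOCC (Function.update d j (r a)) (F a)) :
      IsLOCC d (fun k => ∑ a, (localOp d j (K a))ᴴ * F a k * localOp d j (K a))

/-- A positive operator valued measure with outcomes in `κ`. -/
structure IsPOVM {I κ : Type*} [Fintype I] [DecidableEq I] [Fintype κ]
    (E : κ → Matrix I I ℂ) : Prop where
  posSemidef : ∀ k, (E k).PosSemidef
  sum_eq_one : ∑ k, E k = 1

/-- The states `v 0, …, v (n-1)` of `⨂ j, ℂ^(d j)` are unambiguously locally distinguishable: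
some LOCC decomposable POVM `E 0, …, E n` satisfies, for the conclusive outcomes `k.succ`, that
`⟨v j| E k.succ |v j⟩` vanishes exactly for `j ≠ k`. Outcome `0` is inconclusive. -/
def UnambiguouslyLocallyDistinguishable [DecidableEq ι] [Fintype ι] (d : ι → ℕ) {n : ℕ}
    (v : Fin n → EuclideanSpace ℂ (BasisIndex d)) : Prop :=
  ∃ E : Fin (n + 1) → Matrix (BasisIndex d) (BasisIndex d) ℂ,
    IsPOVM E ∧ IsLOCC d E ∧
      ∀ j k : Fin n, star (v j).ofLp ⬝ᵥ (E k.succ *ᵥ (v j).ofLp) = 0 ↔ j ≠ k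

/-- The local dimensions of `c` separated copies: the parties are the pairs `(t, j)` of a copy `t`
and a party `j` of the original system. -/
abbrev copyDims (c : ℕ) (d : ι → ℕ) : Fin c × ι → ℕ := fun p => d p.2

/-- The vector `v^{⊗c}` of `(⨂ j, ℂ^(d j))^{⊗c} = ⨂ (t, j), ℂ^(d j)`. -/
def copies [Fintype ι] {d : ι → ℕ} (c : ℕ) (v : EuclideanSpace ℂ (BasisIndex d)) :
    EuclideanSpace ℂ (BasisIndex (copyDims c d)) :=
  WithLp.toLp 2 fun x => ∏ t : Fin c, v fun j => x (t, j)

/-- The members of the list `ψ` of pure states of `⨂ j, ℂ^(d j)` are unambiguously locally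
distinguishable, given `c` separated copies of the unknown member. -/
def DistinguishableFromSeparatedCopies [DecidableEq ι] [Fintype ι] (d : ι → ℕ) {n : ℕ}
    (ψ : Fin n → PureState (BasisIndex d)) (c : ℕ) : Prop :=
  UnambiguouslyLocallyDistinguishable (copyDims c d) fun k => copies c (ψ k).ket

end Multipartite

end

/-! Refining an LOCC effect yields rank-one effects given by product functionals. So if outcome `k`
can occur for `ψ k` and for no other member, some product functional of the `c * m` parties is
nonzero on the copies of `ψ k` and kills the copies of every other member
(`IsLOCC.exists_prodForm`). On `c` copies it factors into `c` product functionals on the original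
space (`prodForm_copies`), so each of the `n - 1` other states is killed by one of these.

Up to scaling, product functionals form a family of complex dimension `D = ∑ j, (d j - 1)`, and
killing a state is one complex equation. Hence generically no product functional kills more than `D`
of the states (`volume_annihilated_eq_zero`), and `n - 1 ≤ c * D`. The null set is found for lists
of vectors and carried to pure states through their projectors (`PureState.ae_pi_uniformMeasure`).
-/

noncomputable section

/-! ## Product functionals -/

section ProductFunctionals

variable {ι : Type*} [Fintype ι]

/-- The value of the product functional `⨂ j, φ j` on a vector of `⨂ j, ℂ^(d j)`. -/
def prodForm [DecidableEq ι] {d : ι → ℕ} (φ : ∀ j, Fin (d j) → ℂ) (v : BasisIndex d → ℂ) : ℂ :=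
  ∑ x, (∏ j, φ j (x j)) * v x

variable [DecidableEq ι]

theorem ne_zero_of_prodForm_ne_zero {d : ι → ℕ} {φ : ∀ j, Fin (d j) → ℂ} {v : BasisIndex d → ℂ}
    (h : prodForm φ v ≠ 0) (j : ι) : φ j ≠ 0 := by
  rintro hj
  refine h (Finset.sum_eq_zero fun x _ => ?_)
  rw [Finset.prod_eq_zero (Finset.mem_univ j) (by simp [hj]), zero_mul]

/-- The local factors of `localOp d j K`. -/
def localFactor (d : ι → ℕ) (j : ι) {r : ℕ} (K : Matrix (Fin r) (Fin (d j)) ℂ) (i : ι)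
    (x : Fin (Function.update d j r i)) (y : Fin (d i)) : ℂ :=
  if h : i = j then K (Fin.cast (by simp [h]) x) (Fin.cast (by rw [h]) y)
  else if (x : ℕ) = (y : ℕ) then 1 else 0

theorem localOp_eq_prod (d : ι → ℕ) (j : ι) {r : ℕ} (K : Matrix (Fin r) (Fin (d j)) ℂ)
    (x : BasisIndex (Function.update d j r)) (y : BasisIndex d) :
    localOp d j K x y = ∏ i, localFactor d j K i (x i) (y i) := by
  rw [← Finset.mul_prod_erase _ _ (Finset.mem_univ j)]
  have h1 : localFactor d j K j (x j) (y j) = K (Fin.cast (by simp) (x j)) (y j) := by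
    simp [localFactor]
  have h2 : ∏ i ∈ Finset.univ.erase j, localFactor d j K i (x i) (y i) =
      ∏ i ∈ Finset.univ.erase j, if (x i : ℕ) = (y i : ℕ) then (1 : ℂ) else 0 :=
    Finset.prod_congr rfl fun i hi => by simp [localFactor, Finset.ne_of_mem_erase hi]
  rw [h1, h2, Finset.prod_ite_zero]
  simp [localOp]

/-- Pulling back along a local operator keeps a functional a product; this drives the induction over
LOCC rounds. -/
theorem prodForm_localOp (d : ι → ℕ) (j : ι) {r : ℕ} (K : Matrix (Fin r) (Fin (d j)) ℂ)
    (φ : ∀ i, Fin (Function.update d j r i) → ℂ) (v : BasisIndex d → ℂ) :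
    prodForm φ (localOp d j K *ᵥ v) =
      prodForm (fun i y => ∑ x, φ i x * localFactor d j K i x y) v := by
  simp only [prodForm, Matrix.mulVec, dotProduct, Finset.mul_sum]
  rw [Finset.sum_comm]
  refine Finset.sum_congr rfl fun y _ => ?_
  rw [Finset.prod_univ_sum, Fintype.piFinset_univ, Finset.sum_mul]
  refine Finset.sum_congr rfl fun x _ => ?_
  rw [localOp_eq_prod, Finset.prod_mul_distrib, mul_assoc]

theorem prodForm_single {d : ι → ℕ} (x : BasisIndex d) (v : BasisIndex d → ℂ) :
    prodForm (fun j => Pi.single (x j) 1) v = v x := by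
  rw [prodForm, Finset.sum_eq_single x]
  · simp
  · intro y _ hy
    obtain ⟨j, hj⟩ := Function.ne_iff.1 hy
    rw [Finset.prod_eq_zero (Finset.mem_univ j) (by simp [hj]), zero_mul]
  · simp

theorem prodForm_smul {d : ι → ℕ} (a : ι → ℂ) (φ : ∀ j, Fin (d j) → ℂ) (v : BasisIndex d → ℂ) :
    prodForm (fun j => a j • φ j) v = (∏ j, a j) * prodForm φ v := by
  simp [prodForm, Finset.mul_sum, Finset.prod_mul_distrib, mul_assoc]

theorem prodForm_copies {d : ι → ℕ} (c : ℕ) (φ : ∀ p : Fin c × ι, Fin (copyDims c d p) → ℂ)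
    (v : EuclideanSpace ℂ (BasisIndex d)) :
    prodForm φ (copies c v).ofLp = ∏ t, prodForm (fun j => φ (t, j)) v.ofLp := by
  simp only [prodForm]
  rw [Finset.prod_univ_sum, Fintype.piFinset_univ]
  refine Fintype.sum_equiv
    (⟨fun x t j => x (t, j), fun y p => y p.1 p.2, fun _ => rfl, fun _ => rfl⟩ :
      BasisIndex (copyDims c d) ≃ (Fin c → BasisIndex d)) _ _ fun x => ?_
  simp [copies, Fintype.prod_prod_type, Finset.prod_mul_distrib]

end ProductFunctionals

/-! ## LOCC measurements -/

section LOCC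

variable {ι : Type*} [Fintype ι] [DecidableEq ι]

theorem star_dotProduct_conj_mulVec {I J : Type*} [Fintype I] [Fintype J]
    (L : Matrix J I ℂ) (F : Matrix J J ℂ) (v : I → ℂ) :
    star v ⬝ᵥ ((Lᴴ * F * L) *ᵥ v) = star (L *ᵥ v) ⬝ᵥ (F *ᵥ (L *ᵥ v)) := by
  rw [Matrix.star_mulVec, ← Matrix.dotProduct_mulVec, Matrix.mulVec_mulVec, Matrix.mulVec_mulVec,
    Matrix.mul_assoc]

theorem IsLOCC.posSemidef {κ : Type} [DecidableEq κ] {d : ι → ℕ}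
    {E : κ → Matrix (BasisIndex d) (BasisIndex d) ℂ} (h : IsLOCC d E) (k : κ) :
    (E k).PosSemidef := by
  induction h with
  | announce d k₀ =>
    dsimp only
    split_ifs
    exacts [.one, .zero]
  | measure d j s r K hK F hF ih =>
    exact Matrix.posSemidef_sum _ fun a _ => (ih a).conjTranspose_mul_mul_same _

/-- A LOCC effect that can occur in the state `v` has a refinement to an effect of rank one,
given by a product functional, that can occur in the state `v`. -/
theorem IsLOCC.exists_prodForm {κ : Type} [DecidableEq κ] {d : ι → ℕ}
    {E : κ → Matrix (BasisIndex d) (BasisIndex d) ℂ} (h : IsLOCC d E) (k : κ)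
    (v : BasisIndex d → ℂ) (hv : star v ⬝ᵥ (E k *ᵥ v) ≠ 0) :
    ∃ φ : ∀ j, Fin (d j) → ℂ, prodForm φ v ≠ 0 ∧
      ∀ w : BasisIndex d → ℂ, star w ⬝ᵥ (E k *ᵥ w) = 0 → prodForm φ w = 0 := by
  induction h with
  | announce d k₀ =>
    dsimp only at hv ⊢
    split_ifs at hv ⊢ with hk
    -- The effect is the identity: evaluation at a nonzero coordinate of `v` is a product
    -- functional.
    · simp only [Matrix.one_mulVec, ne_eq, dotProduct_star_self_eq_zero] at hv ⊢
      obtain ⟨x, hx⟩ := Function.ne_iff.1 hv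
      refine ⟨fun j => Pi.single (x j) 1, by simpa [prodForm_single] using hx, ?_⟩
      rintro w rfl
      simp [prodForm_single]
    · simp at hv
  | measure d j s r K hK F hF ih =>
    have key (u : BasisIndex d → ℂ) :
        star u ⬝ᵥ ((∑ a, (localOp d j (K a))ᴴ * F a k * localOp d j (K a)) *ᵥ u) =
          ∑ a, star (localOp d j (K a) *ᵥ u) ⬝ᵥ (F a k *ᵥ (localOp d j (K a) *ᵥ u)) := by
      simp [Matrix.sum_mulVec, dotProduct_sum, star_dotProduct_conj_mulVec]
    simp only [key] at hv ⊢
    obtain ⟨a, -, ha⟩ := Finset.exists_ne_zero_of_sum_ne_zero hv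
    obtain ⟨φ, hφ, hφ'⟩ := ih a _ ha
    refine ⟨_, by rwa [prodForm_localOp] at hφ, fun w hw => ?_⟩
    rw [← prodForm_localOp]
    refine hφ' _ ?_
    -- All branches contribute nonnegatively, so a vanishing total probability forces branch `a` to
    -- vanish on `w`.
    exact (Finset.sum_eq_zero_iff_of_nonneg fun b _ =>
      ((hF b).posSemidef k).dotProduct_mulVec_nonneg _).1 hw a (Finset.mem_univ a)

/-- Copies of `n` states of which no more than `D` are annihilated by a common product functional
are locally unambiguously distinguishable only if `n - 1 ≤ c * D`. -/
theorem DistinguishableFromSeparatedCopies.le_mul {d : ι → ℕ} {n : ℕ}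
    {ψ : Fin n → PureState (BasisIndex d)} {c : ℕ} (h : DistinguishableFromSeparatedCopies d ψ c)
    (D : ℕ) (hD : ∀ S : Finset (Fin n), D < S.card →
      ¬ ∃ φ : ∀ j, Fin (d j) → ℂ, (∀ j, φ j ≠ 0) ∧ ∀ i ∈ S, prodForm φ (ψ i).ket.ofLp = 0) :
    n - 1 ≤ c * D := by
  rcases Nat.eq_zero_or_pos n with rfl | hn
  · simp
  obtain ⟨E, -, hE, hψ⟩ := h
  let k : Fin n := ⟨0, hn⟩
  obtain ⟨φ, hφ, hφ'⟩ := hE.exists_prodForm k.succ (copies c (ψ k).ket).ofLp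
    (fun h0 => (hψ k k).1 h0 rfl)
  rw [prodForm_copies] at hφ
  have hφ0 (t : Fin c) : prodForm (fun j => φ (t, j)) (ψ k).ket.ofLp ≠ 0 :=
    Finset.prod_ne_zero_iff.1 hφ t (Finset.mem_univ t)
  have hex (i : Fin n) (hi : i ∈ Finset.univ.erase k) :
      ∃ t : Fin c, prodForm (fun j => φ (t, j)) (ψ i).ket.ofLp = 0 := by
    have := hφ' _ ((hψ i k).2 (Finset.ne_of_mem_erase hi))
    rw [prodForm_copies, Finset.prod_eq_zero_iff] at this
    exact this.imp fun t ht => ht.2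
  by_contra! hlt
  -- The `n - 1` other labels are covered by `c` sets of at most `D` labels each.
  have hsub : Finset.univ.erase k ⊆ Finset.univ.biUnion fun t : Fin c =>
      Finset.univ.filter fun i => prodForm (fun j => φ (t, j)) (ψ i).ket.ofLp = 0 := by
    intro i hi
    simpa using hex i hi
  have hcard := (Finset.card_le_card hsub).trans
    (Finset.card_biUnion_le_card_mul _ _ D fun t _ => by
      by_contra! hS
      exact hD _ hS ⟨fun j => φ (t, j), ne_zero_of_prodForm_ne_zero (hφ0 t), by simp⟩)
  simp at hcard
  omega

end LOCC

/-! ## Vectors annihilated by a common product functional -/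

section NullSet

/-- A `C¹` map does not raise Hausdorff dimension, and Haar measure is absolutely continuous with
respect to the Hausdorff measure of full dimension. -/
theorem ContDiff.measure_range_eq_zero {V W : Type*} [NormedAddCommGroup V] [NormedSpace ℝ V]
    [FiniteDimensional ℝ V] [NormedAddCommGroup W] [NormedSpace ℝ W] [FiniteDimensional ℝ W]
    [MeasurableSpace W] [BorelSpace W] (μ : Measure W) [μ.IsAddHaarMeasure] {f : V → W}
    (hf : ContDiff ℝ 1 f) (h : Module.finrank ℝ V < Module.finrank ℝ W) :
    μ (Set.range f) = 0 := by
  have h1 : dimH (Set.range f) < ((Module.finrank ℝ W : NNReal) : ℝ≥0∞) :=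
    hf.dimH_range_le.trans_lt (by exact_mod_cast h)
  have h2 := hausdorffMeasure_of_dimH_lt h1
  exact Measure.absolutelyContinuous_isAddHaarMeasure μ
    (Measure.hausdorffMeasure (X := W) (Module.finrank ℝ W)) (by simpa using h2)

variable {ι : Type*} [Fintype ι] [DecidableEq ι]

/-- The product functionals whose factors have the value `1` at the labels `x₀` of a basis vector
are parametrized by the other values of their factors. -/
def chartFactor {d : ι → ℕ} (x₀ : BasisIndex d) (a : (Σ j, { k : Fin (d j) // k ≠ x₀ j }) → ℂ)
    (j : ι) (k : Fin (d j)) : ℂ :=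
  if h : k = x₀ j then 1 else a ⟨j, k, h⟩

theorem prodForm_chartFactor {d : ι → ℕ} (x₀ : BasisIndex d)
    (a : (Σ j, { k : Fin (d j) // k ≠ x₀ j }) → ℂ) (v : BasisIndex d → ℂ) :
    prodForm (chartFactor x₀ a) v =
      v x₀ + ∑ y ∈ Finset.univ.erase x₀, (∏ j, chartFactor x₀ a j (y j)) * v y := by
  rw [prodForm, ← Finset.add_sum_erase _ _ (Finset.mem_univ x₀)]
  simp [chartFactor]

/-- A parametrization of the lists of vectors with the property that the members with labels in `S`
are annihilated by a common product functional with factors that do not vanish at `x₀`. -/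
def chartMap {d : ι → ℕ} {n : ℕ} (S : Finset (Fin n)) (x₀ : BasisIndex d)
    (p : ((Σ j, { k : Fin (d j) // k ≠ x₀ j }) → ℂ) ×
      ({ q : Fin n × BasisIndex d // ¬ (q.1 ∈ S ∧ q.2 = x₀) } → ℂ)) :
    Fin n → EuclideanSpace ℂ (BasisIndex d) := fun i => WithLp.toLp 2 fun x =>
  if h : i ∈ S ∧ x = x₀ then
    -- The equation is solved for the coordinate at `x₀`, whose coefficient is `1`.
    -∑ y : { y // y ≠ x₀ }, (∏ j, chartFactor x₀ p.1 j (y.1 j)) * p.2 ⟨(i, y.1), fun hy => y.2 hy.2⟩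
  else p.2 ⟨(i, x), h⟩

theorem contDiff_chartMap {d : ι → ℕ} {n : ℕ} (S : Finset (Fin n)) (x₀ : BasisIndex d) :
    ContDiff ℝ 1 (chartMap S x₀) := by
  refine contDiff_pi.2 fun i => (PiLp.contDiff_toLp).comp (contDiff_pi.2 fun x => ?_)
  have hc (j : ι) (k : Fin (d j)) :
      ContDiff ℝ 1 fun a : (Σ j, { k : Fin (d j) // k ≠ x₀ j }) → ℂ => chartFactor x₀ a j k := by
    unfold chartFactor
    split_ifs <;> fun_prop
  split_ifs with h
  · refine (ContDiff.sum fun y _ => ContDiff.mul (contDiff_prod fun j _ =>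
      (hc j _).comp contDiff_fst) ?_).neg
    fun_prop
  · fun_prop

theorem mem_range_chartMap {d : ι → ℕ} {n : ℕ} {S : Finset (Fin n)} {φ : ∀ j, Fin (d j) → ℂ}
    (hφ : ∀ j, φ j ≠ 0) {w : Fin n → EuclideanSpace ℂ (BasisIndex d)}
    (hw : ∀ i ∈ S, prodForm φ (w i).ofLp = 0) :
    ∃ x₀ : BasisIndex d, w ∈ Set.range (chartMap S x₀) := by
  choose x₀ hx₀ using fun j => Function.ne_iff.1 (hφ j)
  -- Rescaling each factor to have the value `1` at `x₀ j` does not affect which vectors are killed.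
  let a : (Σ j, { k : Fin (d j) // k ≠ x₀ j }) → ℂ := fun q => (φ q.1 (x₀ q.1))⁻¹ * φ q.1 q.2.1
  have ha : chartFactor x₀ a = fun j => (φ j (x₀ j))⁻¹ • φ j := by
    funext j k
    simp only [chartFactor, a, Pi.smul_apply, smul_eq_mul]
    split_ifs with h
    · rw [h, inv_mul_cancel₀ (hx₀ j)]
    · rfl
  refine ⟨x₀, (a, fun q => w q.1.1 q.1.2), funext fun i => PiLp.ext fun x => ?_⟩
  simp only [chartMap]
  split_ifs with h
  · obtain ⟨hi, rfl⟩ := h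
    have h0 : prodForm (chartFactor x a) (w i).ofLp = 0 := by
      rw [ha, prodForm_smul, hw i hi, mul_zero]
    rw [prodForm_chartFactor] at h0
    rw [eq_neg_of_add_eq_zero_left h0, neg_inj]
    exact (Finset.sum_subtype (Finset.univ.erase x) (by simp)
      fun y => (∏ j, chartFactor x a j (y j)) * (w i).ofLp y).symm
  · rfl

/-- Each of the finitely many charts gains `∑ j, (d j - 1)` complex parameters from the functional
and loses `S.card` coordinates, so its image has too small a dimension. -/
theorem volume_annihilated_eq_zero {d : ι → ℕ} {n : ℕ} (S : Finset (Fin n))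
    (hS : ∑ j, (d j - 1) < S.card) :
    volume { w : Fin n → EuclideanSpace ℂ (BasisIndex d) |
      ∃ φ : ∀ j, Fin (d j) → ℂ, (∀ j, φ j ≠ 0) ∧ ∀ i ∈ S, prodForm φ (w i).ofLp = 0 } = 0 := by
  have : (volume : Measure (Fin n → EuclideanSpace ℂ (BasisIndex d))).IsAddHaarMeasure :=
    Measure.pi.isAddHaarMeasure _
  refine measure_mono_null (t := ⋃ x₀, Set.range (chartMap S x₀))
    (fun w ⟨φ, hφ, hw⟩ => Set.mem_iUnion.2 (mem_range_chartMap hφ hw))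
    (measure_iUnion_null fun x₀ => (contDiff_chartMap S x₀).measure_range_eq_zero volume ?_)
  have h1 : Fintype.card (Σ j, { k : Fin (d j) // k ≠ x₀ j }) = ∑ j, (d j - 1) := by
    simp [Fintype.card_subtype_compl]
  have h2 : Fintype.card { q : Fin n × BasisIndex d // q.1 ∈ S ∧ q.2 = x₀ } = S.card := by
    rw [Fintype.card_subtype, show Finset.univ.filter
      (fun q : Fin n × BasisIndex d => q.1 ∈ S ∧ q.2 = x₀) = S ×ˢ {x₀} from
        Finset.ext fun q => by simp only [Finset.mem_filter_univ, Finset.mem_product,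
          Finset.mem_singleton], Finset.card_product, Finset.card_singleton, mul_one]
  -- This keeps the natural subtraction in `h4` from truncating.
  have h3 : Fintype.card { q : Fin n × BasisIndex d // q.1 ∈ S ∧ q.2 = x₀ } ≤
    Fintype.card (Fin n × BasisIndex d) := Fintype.card_subtype_le _
  have h4 : Fintype.card { q : Fin n × BasisIndex d // ¬ (q.1 ∈ S ∧ q.2 = x₀) } =
      Fintype.card (Fin n × BasisIndex d) - S.card := by
    rw [Fintype.card_subtype_compl, h2]
  have h5 : Module.finrank ℝ (Fin n → EuclideanSpace ℂ (BasisIndex d)) =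
      Fintype.card (Fin n × BasisIndex d) * 2 := by
    rw [← Module.finrank_mul_finrank ℝ ℂ, Module.finrank_pi_fintype]
    simp [mul_comm]
  rw [h5, Module.finrank_prod, Module.finrank_pi_fintype, Module.finrank_pi_fintype]
  simp only [Complex.finrank_real_complex, Finset.sum_const, Finset.card_univ, h1, h4, smul_eq_mul]
  omega

end NullSet

/-! ## From vectors to pure states -/

section Projector

variable {I : Type*} [Fintype I]

/-- The entries of the orthogonal projector onto the line spanned by `v`. -/
def projectorEntries (v : EuclideanSpace ℂ I) (x y : I) : ℂ :=
  v x * star (v y) / ((‖v‖ ^ 2 : ℝ) : ℂ)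

theorem projectorEntries_smul {a : ℂ} (ha : a ≠ 0) (v : EuclideanSpace ℂ I) :
    projectorEntries (a • v) = projectorEntries v := by
  funext x y
  have h : (a * star a) = ((‖a‖ ^ 2 : ℝ) : ℂ) := by
    simpa using Complex.mul_conj' a
  have h0 : ((‖a‖ ^ 2 : ℝ) : ℂ) ≠ 0 := by simpa using ha
  simp only [projectorEntries, PiLp.smul_apply, smul_eq_mul, norm_smul, mul_pow, star_mul']
  rw [mul_mul_mul_comm, h, Complex.ofReal_mul, mul_div_mul_left _ _ h0]

theorem measurable_projectorEntries :
    Measurable (projectorEntries : EuclideanSpace ℂ I → I → I → ℂ) := by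
  refine measurable_pi_lambda _ fun x => measurable_pi_lambda _ fun y => ?_
  unfold projectorEntries
  refine Measurable.div (Continuous.measurable ?_) (Continuous.measurable ?_) <;> fun_prop

theorem sum_projectorEntries (f : I → ℂ) (v : EuclideanSpace ℂ I) :
    ∑ x, ∑ y, f x * projectorEntries v x y * star (f y) =
      (∑ x, f x * v x) * star (∑ x, f x * v x) / ((‖v‖ ^ 2 : ℝ) : ℂ) := by
  rw [star_sum, Finset.sum_mul_sum, Finset.sum_div]
  refine Finset.sum_congr rfl fun x _ => ?_
  rw [Finset.sum_div]
  refine Finset.sum_congr rfl fun y _ => ?_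
  rw [projectorEntries, star_mul']
  ring

theorem sum_projectorEntries_eq_zero_iff (f : I → ℂ) (v : EuclideanSpace ℂ I) :
    ∑ x, ∑ y, f x * projectorEntries v x y * star (f y) = 0 ↔ ∑ x, f x * v x = 0 := by
  rw [sum_projectorEntries]
  rcases eq_or_ne v 0 with rfl | hv
  · simp
  · rw [div_eq_zero_iff, or_iff_left (by simpa using hv), mul_eq_zero, star_eq_zero, or_self]

namespace PureState

theorem ket_eq_smul_rep (ψ : PureState I) :
    ∃ a : ℂ, a ≠ 0 ∧ ψ.ket = a • Projectivization.rep ψ :=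
  ⟨_, by simpa using Projectivization.rep_nonzero ψ, rfl⟩

theorem projectorEntries_ket_mk (v : EuclideanSpace ℂ I) (hv : v ≠ 0) :
    projectorEntries (PureState.ket (Projectivization.mk ℂ v hv)) = projectorEntries v := by
  obtain ⟨a, ha, h⟩ := ket_eq_smul_rep (Projectivization.mk ℂ v hv)
  obtain ⟨b, hb⟩ := Projectivization.exists_smul_eq_mk_rep ℂ v hv
  rw [h, projectorEntries_smul ha, ← hb, Units.smul_def, projectorEntries_smul b.ne_zero]

theorem continuous_projectorEntries_ket :
    Continuous fun ψ : PureState I => projectorEntries ψ.ket := by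
  refine continuous_coinduced_dom.2 ?_
  have h : (fun ψ : PureState I => projectorEntries ψ.ket) ∘ (Projectivization.mk' ℂ :
      { v : EuclideanSpace ℂ I // v ≠ 0 } → Projectivization ℂ (EuclideanSpace ℂ I)) =
      fun v => projectorEntries v.1 := funext fun v => projectorEntries_ket_mk v.1 v.2
  rw [h]
  refine continuous_pi fun x => continuous_pi fun y => Continuous.div ?_ ?_ fun v => ?_
  · fun_prop
  · fun_prop
  · simpa using v.2

theorem continuous_ofUnit : Continuous (ofUnit : _ → PureState I) :=
  continuous_coinduced_rng.comp (f := fun v : Metric.sphere (0 : EuclideanSpace ℂ I) 1 =>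
    (⟨v, ne_zero_of_mem_unit_sphere v⟩ : { v : EuclideanSpace ℂ I // v ≠ 0 })) (by fun_prop)

instance [Nonempty I] : IsProbabilityMeasure (uniformMeasure I) := by
  have : IsProbabilityMeasure (sphereMeasure I) := by
    refine ⟨?_⟩
    rw [sphereMeasure, Measure.smul_apply, smul_eq_mul]
    exact ENNReal.inv_mul_cancel (Measure.measure_univ_ne_zero.2 (Measure.toSphere_ne_zero _))
      (measure_ne_top _ _)
  exact Measure.isProbabilityMeasure_map continuous_ofUnit.measurable.aemeasurable

/-- The projector onto a uniformly distributed pure state has the law of the projector onto a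
uniformly distributed vector of the unit ball. -/
theorem map_projectorEntries_uniformMeasure :
    ∃ a : ℝ≥0∞, (uniformMeasure I).map (fun ψ => projectorEntries ψ.ket) =
      a • ((volume : Measure (EuclideanSpace ℂ I)).restrict (Metric.ball 0 1 \ {0})).map
        projectorEntries := by
  -- `toSphere` of a set is the real dimension times the volume of the cone over it, which accounts
  -- for the second factor.
  refine ⟨((volume : Measure (EuclideanSpace ℂ I)).toSphere Set.univ)⁻¹ *
    Module.finrank ℝ (EuclideanSpace ℂ I), ?_⟩
  ext s hs
  have hm := (continuous_projectorEntries_ket (I := I)).measurable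
  have hu : Measurable (ofUnit : _ → PureState I) := continuous_ofUnit.measurable
  rw [Measure.map_apply hm hs, uniformMeasure, Measure.map_apply hu (hm hs), sphereMeasure,
    Measure.smul_apply, Measure.smul_apply, Measure.toSphere_apply' _ (hu (hm hs)),
    Measure.map_apply measurable_projectorEntries hs,
    Measure.restrict_apply (measurable_projectorEntries hs), smul_eq_mul, smul_eq_mul, mul_assoc]
  congr 3
  have hpre : ofUnit ⁻¹' ((fun ψ : PureState I => projectorEntries ψ.ket) ⁻¹' s) =
      { u | projectorEntries u.1 ∈ s } :=
    Set.ext fun u => iff_of_eq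
      (congrArg (· ∈ s) (projectorEntries_ket_mk u.1 (ne_zero_of_mem_unit_sphere u)))
  rw [hpre]
  -- By scale invariance of the projector, the cone over the preimage of `s` in the sphere is its
  -- preimage in the punctured ball.
  ext v
  rw [Set.mem_smul]
  constructor
  · rintro ⟨r, hr, _, ⟨u, hu, rfl⟩, rfl⟩
    have hr0 : (r : ℂ) ≠ 0 := by exact_mod_cast hr.1.ne'
    have hn : ‖(u : EuclideanSpace ℂ I)‖ = 1 := norm_eq_of_mem_sphere u
    have he : r • (u : EuclideanSpace ℂ I) = (r : ℂ) • (u : EuclideanSpace ℂ I) :=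
      (Complex.coe_smul r _).symm
    refine ⟨?_, ?_, ?_⟩
    · rw [he, Set.mem_preimage, projectorEntries_smul hr0]
      exact hu
    · simpa [norm_smul, hn, abs_of_pos hr.1] using hr.2
    · simpa using ⟨hr.1.ne', ne_zero_of_mem_unit_sphere u⟩
  · rintro ⟨hv, hv1, hv0 : v ≠ 0⟩
    have hn : ‖v‖ ≠ 0 := norm_ne_zero_iff.2 hv0
    refine ⟨‖v‖, ⟨norm_pos_iff.2 hv0, by simpa using hv1⟩, ‖v‖⁻¹ • v,
      ⟨⟨‖v‖⁻¹ • v, by simp [norm_smul, hn]⟩, ?_, rfl⟩, by simp [smul_smul, hn]⟩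
    have he : ‖v‖⁻¹ • v = ((‖v‖⁻¹ : ℝ) : ℂ) • v := (Complex.coe_smul _ _).symm
    change projectorEntries (‖v‖⁻¹ • v) ∈ s
    rw [he, projectorEntries_smul (by simpa using hv0)]
    exact hv

/-- Almost no list of pure states has a property of the list of projectors that holds for almost no
list of vectors. -/
theorem ae_pi_uniformMeasure [Nonempty I] {n : ℕ} {C : Set (Fin n → I → I → ℂ)}
    (hC : MeasurableSet C)
    (h : volume { w : Fin n → EuclideanSpace ℂ I | (fun i => projectorEntries (w i)) ∈ C } = 0) :
    ∀ᵐ ψ : Fin n → PureState I ∂(Measure.pi fun _ => uniformMeasure I),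
      (fun i => projectorEntries (ψ i).ket) ∉ C := by
  have hm := (continuous_projectorEntries_ket (I := I)).measurable
  have hm' := measurable_projectorEntries (I := I)
  have hm'' : Measurable fun (w : Fin n → EuclideanSpace ℂ I) i => projectorEntries (w i) :=
    measurable_pi_lambda _ fun i => hm'.comp (measurable_pi_apply i)
  have : IsFiniteMeasure ((volume : Measure (EuclideanSpace ℂ I)).restrict
      (Metric.ball 0 1 \ {0})) :=
    ⟨by simpa using (measure_mono Set.sdiff_subset).trans_lt measure_ball_lt_top⟩
  refine ae_of_ae_map (f := fun (ψ : Fin n → PureState I) i => projectorEntries (ψ i).ket)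
    (p := fun A => A ∉ C)
    (measurable_pi_lambda _ fun i => hm.comp (measurable_pi_apply i)).aemeasurable ?_
  have h1 : IsProbabilityMeasure ((uniformMeasure I).map fun ψ => projectorEntries ψ.ket) :=
    Measure.isProbabilityMeasure_map hm.aemeasurable
  rw [Measure.pi_map_pi fun _ => hm.aemeasurable]
  obtain ⟨a, ha⟩ := map_projectorEntries_uniformMeasure (I := I)
  have h2 : (Measure.pi fun _ : Fin n =>
      (uniformMeasure I).map fun ψ => projectorEntries ψ.ket) = a ^ n •
      Measure.pi fun _ : Fin n => ((volume : Measure (EuclideanSpace ℂ I)).restrict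
        (Metric.ball 0 1 \ {0})).map projectorEntries := by
    refine Measure.pi_eq fun s hs => ?_
    simp [ha, Finset.prod_mul_distrib]
  rw [h2]
  refine Measure.ae_smul_measure ?_ _
  rw [← Measure.pi_map_pi fun _ => hm'.aemeasurable, ae_map_iff hm''.aemeasurable hC.compl,
    ← Measure.restrict_pi_pi]
  refine ae_restrict_of_ae ?_
  rw [← volume_pi, ae_iff]
  simpa using h

end PureState

end Projector

/-! ### Almost sure genericity of lists of pure states -/

section Generic

variable {ι : Type*} [Fintype ι] [DecidableEq ι]

/-- The lists of matrices `A` such that `⟨φ|A i|φ⟩ = 0` for all `i ∈ S`, for some common product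
vector `φ`. -/
def annihilatedMatrices (d : ι → ℕ) {n : ℕ} (S : Finset (Fin n)) :
    Set (Fin n → BasisIndex d → BasisIndex d → ℂ) :=
  { A | ∃ φ ∈ Set.univ.pi fun j => Metric.sphere (0 : Fin (d j) → ℂ) 1,
    ∀ i ∈ S, ∑ x, ∑ y, (∏ j, φ j (x j)) * A i x y * star (∏ j, φ j (y j)) = 0 }

/-- The unit factors range over a compact product of spheres, and projecting along a compact factor
is a closed map. Closedness supplies the measurability needed to transfer null sets between laws. -/
theorem isClosed_annihilatedMatrices (d : ι → ℕ) {n : ℕ} (S : Finset (Fin n)) :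
    IsClosed (annihilatedMatrices d S) := by
  let K : Set (∀ j, Fin (d j) → ℂ) := Set.univ.pi fun j => Metric.sphere (0 : Fin (d j) → ℂ) 1
  have : CompactSpace K := isCompact_iff_compactSpace.1
    (isCompact_univ_pi fun j => isCompact_sphere (0 : Fin (d j) → ℂ) 1)
  have hp (x : BasisIndex d) :
      Continuous fun p : K × (Fin n → BasisIndex d → BasisIndex d → ℂ) => ∏ j, p.1.1 j (x j) :=
    continuous_finsetProd _ fun j _ => (continuous_apply (x j)).comp
      ((continuous_apply j).comp (continuous_subtype_val.comp continuous_fst))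
  have hcl : IsClosed { p : K × (Fin n → BasisIndex d → BasisIndex d → ℂ) | ∀ i ∈ S,
      ∑ x, ∑ y, (∏ j, p.1.1 j (x j)) * p.2 i x y * star (∏ j, p.1.1 j (y j)) = 0 } := by
    simp only [Set.ofPred_forall]
    exact isClosed_iInter fun i => isClosed_iInter fun _ => isClosed_eq
      (continuous_finsetSum _ fun x _ => continuous_finsetSum _ fun y _ =>
        ((hp x).mul (by fun_prop)).mul (hp y).star) continuous_const
  convert isClosedMap_snd_of_compactSpace _ hcl using 1
  ext A
  simp [annihilatedMatrices, K]

theorem projectorEntries_mem_annihilatedMatrices_iff {d : ι → ℕ} {n : ℕ} (S : Finset (Fin n))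
    (w : Fin n → EuclideanSpace ℂ (BasisIndex d)) :
    (fun i => projectorEntries (w i)) ∈ annihilatedMatrices d S ↔
      ∃ φ : ∀ j, Fin (d j) → ℂ, (∀ j, φ j ≠ 0) ∧ ∀ i ∈ S, prodForm φ (w i).ofLp = 0 := by
  simp only [annihilatedMatrices, Set.mem_ofPred_eq, Set.mem_univ_pi,
    sum_projectorEntries_eq_zero_iff]
  constructor
  · rintro ⟨φ, hφ, h⟩
    exact ⟨φ, fun j => ne_zero_of_mem_unit_sphere ⟨φ j, hφ j⟩, h⟩
  · rintro ⟨φ, hφ, h⟩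
    refine ⟨fun j => ((‖φ j‖⁻¹ : ℝ) : ℂ) • φ j, fun j => ?_, fun i hi => ?_⟩
    · simp [norm_smul, hφ j]
    · exact (prodForm_smul _ φ _).trans (by rw [h i hi, mul_zero])

/-- Almost surely, no more than `∑ j, (d j - 1)` members of a list of pure states are annihilated
by a common product functional. -/
theorem ae_not_annihilated (d : ι → ℕ) (hd : ∀ j, 0 < d j) (n : ℕ) :
    ∀ᵐ ψ : Fin n → PureState (BasisIndex d)
        ∂(Measure.pi fun _ : Fin n => PureState.uniformMeasure (BasisIndex d)),
      ∀ S : Finset (Fin n), ∑ j, (d j - 1) < S.card →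
        ¬ ∃ φ : ∀ j, Fin (d j) → ℂ, (∀ j, φ j ≠ 0) ∧
          ∀ i ∈ S, prodForm φ (ψ i).ket.ofLp = 0 := by
  have : Nonempty (BasisIndex d) := ⟨fun j => ⟨0, hd j⟩⟩
  refine ae_all_iff.2 fun S => ?_
  by_cases hS : ∑ j, (d j - 1) < S.card
  · filter_upwards [PureState.ae_pi_uniformMeasure (isClosed_annihilatedMatrices d S).measurableSet
      (by simpa only [projectorEntries_mem_annihilatedMatrices_iff] using
        volume_annihilated_eq_zero S hS)] with ψ hψ _
    exact fun h => hψ ((projectorEntries_mem_annihilatedMatrices_iff S _).2 h)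
  · exact .of_forall fun ψ h => absurd h hS

end Generic

end

theorem mainTheorem7 (m : ℕ) (d : Fin m → ℕ) (hd : ∀ j, 0 < d j) (n : ℕ) :
    ∀ᵐ ψ : Fin n → PureState (BasisIndex d)
        ∂(Measure.pi fun _ : Fin n => PureState.uniformMeasure (BasisIndex d)),
      ∀ c : ℕ, DistinguishableFromSeparatedCopies d ψ c →
        (∑ j, ((d j : ℝ) - 1) = 0 → n ≤ 1) ∧
          ((n : ℝ) - 1) / ∑ j, ((d j : ℝ) - 1) ≤ (c : ℝ) := by
  filter_upwards [ae_not_annihilated d hd n] with ψ hψ c hc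
  have hle := hc.le_mul _ hψ
  have hsum : ∑ j, ((d j : ℝ) - 1) = ((∑ j, (d j - 1) : ℕ) : ℝ) := by
    push_cast [Nat.cast_sub (Nat.succ_le_of_lt (hd _))]
    rfl
  rw [hsum]
  -- The division bound needs only a nonnegative denominator, so it covers the zero sum, where the
  -- quotient is `0` by convention.
  refine ⟨fun h => ?_, div_le_of_le_mul₀ (Nat.cast_nonneg _) (Nat.cast_nonneg _) ?_⟩
  · rw [Nat.cast_eq_zero.1 h] at hle
    omega
  · rw [sub_le_iff_le_add]
    exact_mod_cast Nat.sub_le_iff_le_add.1 hle
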